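/- Let $X_1,X_2,\dots$ be real random variables on a probability space such that for every $n$ each of the $n!$ strict orderings of $X_1,\dots,X_n$ has probability $1/n!$ (for example, i.i.d. random variables with a continuous distribution function). For $1\le i\le n$ let $R_i^n=\#\{1\le j\le n: X_j\le X_i\}$ be the rank of $X_i$ among the first $n$ observations. Let $0<p<\tfrac12$, and let $r(0)=1$ and $r(k)=\lceil pk\rceil$ for $k\ge 1$. Define the random sets $S_n$ of indices of retained observations by $S_0=\emptyset$ and, for $n\ge1$, $S_n=S_{n-1}\cup\{n\}$ if $R_n^n\le r(L_{n-1})$ and $S_n=S_{n-1}$ otherwise, where $L_n=\#S_n$ (this is the $p$-percentile rule). For $n\ge1$ let $$A_n=\frac1{L_n}\sum_{i\in S_n}R_i^n$$ be the average rank of the retained observations. Then there is a real-valued random variable $Y$ which is nondegenerate, that is, not almost surely equal to a constant, such that $$\frac{A_n}{n^{1-p}}\longrightarrow Y\quad\text{almost surely as } n\to\infty .$$ -/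

import Mathlib

open MeasureTheory ProbabilityTheory Filter Topology

/-- Every strict ordering of the first `n` observations `X 0, …, X (n - 1)` has probability `1 / n!`,
for every `n`. (The `n!` events are disjoint, so ties have probability zero.) -/
def EquallyLikelyOrderings {Ω : Type*} [MeasurableSpace Ω] (P : Measure Ω) (X : ℕ → Ω → ℝ) : Prop :=
  ∀ (n : ℕ) (σ : Equiv.Perm (Fin n)),
    P {ω | StrictMono fun i : Fin n => X (σ i) ω} = ((n.factorial : ℕ) : ENNReal)⁻¹

/-- Rank of the observation with index `i` among the first `n` observations `x 0, …, x (n - 1)`;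
the smallest observation has rank `1`. -/
noncomputable def obsRank (x : ℕ → ℝ) (n i : ℕ) : ℕ :=
  ((Finset.range n).filter fun j => x j ≤ x i).card

/-- The set of indices retained after `n` observations by the rank selection rule with threshold
function `r`: the next observation `x n` is retained if and only if its rank among
`x 0, …, x n` is at most `r` of the number of observations retained so far. -/
noncomputable def retained (r : ℕ → ℕ) (x : ℕ → ℝ) : ℕ → Finset ℕ
  | 0 => ∅
  | n + 1 =>
    if obsRank x (n + 1) n ≤ r (retained r x n).card then insert n (retained r x n)
    else retained r x n

/-- The threshold function of the `p`-percentile rule: `r 0 = 1` and `r k = ⌈p k⌉` for `k ≥ 1`. -/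
noncomputable def percentileThreshold (p : ℝ) (k : ℕ) : ℕ :=
  if k = 0 then 1 else ⌈p * (k : ℝ)⌉₊

/-- Average rank, among the first `n` observations, of the observations retained after `n`
observations (meaningful for `n ≥ 1`, when at least one observation has been retained). -/
noncomputable def averageRank (r : ℕ → ℕ) (x : ℕ → ℝ) (n : ℕ) : ℝ :=
  ((∑ i ∈ retained r x n, obsRank x n i : ℕ) : ℝ) / ((retained r x n).card : ℝ)

/-! Equally likely orderings mean that the relative ranks are independent and uniform
(`map_relRanks`), and almost surely there are no ties, so `averageRank` is a function of the
relative ranks. Write L for the number retained, Q for the sum of their ranks and g(n) = ∏_{k<n} (1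
+ p/(k+1)), which is of order n^p.

Convergence comes from three nonnegative supermartingales. (L + 1/p)/g(n) converges because r(L) ≤
pL + 1. A weight comparable with 1/L, times g(n), also converges, which keeps the limit of L/g(n)
away from 0. Finally Q/(n+1) becomes a supermartingale after adding a multiple of (L + 1/p)(L + 1/p
+ 1)/(n+1); since L is of order n^p and 2p < 1, this correction vanishes in the limit. Hence L/n^p
tends to a positive limit, Q/n converges, and so does (Q/L)/n^(1-p).

For nondegeneracy, take the event that the third of the first three observations is their median and
the second is their minimum. Making the third the maximum instead preserves the law and, as r(2) = 1
rejects it in both cases, changes no retention decision; it only alters the rank of the first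
observation. The mean of that alteration grows linearly in n (`integral_indicator_rankGap`), whereas
a constant limit would force it to be o(n) (`not_ae_tendsto_const`). -/

/-! ### Independent uniform relative ranks -/

/-- Sequences of relative ranks, counted from zero: the `n`-th term is the number of earlier
observations that are smaller than the `n`-th one. -/
abbrev RankSeq : Type := ∀ n : ℕ, Fin (n + 1)

/-- The law under which the relative ranks are independent and uniform. -/
noncomputable def rankLaw : Measure RankSeq :=
  Measure.infinitePi fun n => uniformOn (Set.univ : Set (Fin (n + 1)))

instance : IsProbabilityMeasure rankLaw := by unfold rankLaw; infer_instance

theorem uniformOn_univ_fin_singleton (n : ℕ) (k : Fin (n + 1)) :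
    uniformOn (Set.univ : Set (Fin (n + 1))) {k} = ((n + 1 : ℕ) : ENNReal)⁻¹ := by
  rw [uniformOn_univ, Measure.count_singleton, Fintype.card_fin, one_div]

/-- Resampling one coordinate independently does not change a product law. This makes `stepMean` act
as conditional expectation given the other coordinates. -/
theorem measurePreserving_update (n : ℕ) :
    MeasurePreserving (fun q : RankSeq × Fin (n + 1) => Function.update q.1 n q.2)
      (rankLaw.prod (uniformOn Set.univ)) rankLaw := by
  have hm : Measurable (fun q : RankSeq × Fin (n + 1) => Function.update q.1 n q.2) := by
    refine measurable_pi_lambda _ fun i => ?_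
    by_cases h : i = n
    · subst h; simpa using measurable_snd
    · simp only [Function.update_of_ne h]
      exact (measurable_pi_apply i).comp measurable_fst
  refine ⟨hm, ?_⟩
  refine Measure.eq_infinitePi _ fun s t ht => ?_
  rw [Measure.map_apply hm (.pi s.countable_toSet fun i _ => ht i)]
  have hpre : (fun q : RankSeq × Fin (n + 1) => Function.update q.1 n q.2) ⁻¹' Set.pi s t
      = Set.pi (s.erase n : Finset ℕ) t ×ˢ (if n ∈ s then t n else Set.univ) := by
    ext ⟨a, k⟩
    simp only [Set.mem_preimage, Set.mem_pi, Set.mem_prod, Finset.mem_coe, Finset.mem_erase]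
    constructor
    · intro h
      refine ⟨fun i hi => by simpa [Function.update_of_ne hi.1] using h i hi.2, ?_⟩
      split_ifs with hn
      · simpa using h n hn
      · trivial
    · rintro ⟨h1, h2⟩ i hi
      by_cases h : i = n
      · subst h; simpa [hi] using h2
      · simpa [Function.update_of_ne h] using h1 i ⟨h, hi⟩
  rw [hpre, Measure.prod_prod, rankLaw, Measure.infinitePi_pi _ fun i _ => ht i]
  split_ifs with hn
  · rw [Finset.prod_erase_mul _ _ hn]
  · rw [measure_univ, mul_one, Finset.erase_eq_of_notMem hn]

/-! ### One-step averages and supermartingale convergence -/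

/-- Averaging over the `n`-th relative rank. -/
noncomputable def stepMean (n : ℕ) (F : RankSeq → ℝ) (a : RankSeq) : ℝ :=
  (∑ k : Fin (n + 1), F (Function.update a n k)) / ((n : ℝ) + 1)

theorem integral_stepMean (n : ℕ) {F : RankSeq → ℝ} (hF : Integrable F rankLaw) :
    ∫ a, stepMean n F a ∂rankLaw = ∫ a, F a ∂rankLaw := by
  have hp := measurePreserving_update n
  have hF' : Integrable (fun q : RankSeq × Fin (n + 1) => F (Function.update q.1 n q.2))
      (rankLaw.prod (uniformOn Set.univ)) := hp.integrable_comp_of_integrable hF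
  have h1 : ∫ q, F (Function.update q.1 n q.2) ∂(rankLaw.prod (uniformOn Set.univ))
      = ∫ a, F a ∂rankLaw := by
    conv_rhs => rw [← hp.map_eq]
    rw [integral_map hp.measurable.aemeasurable]
    rw [hp.map_eq]; exact hF.aestronglyMeasurable
  rw [← h1, integral_prod _ hF']
  refine integral_congr_ae (.of_forall fun a => ?_)
  simp only [stepMean]
  rw [integral_fintype (Integrable.of_finite)]
  simp only [Measure.real, uniformOn_univ_fin_singleton, smul_eq_mul, ENNReal.toReal_inv,
    ENNReal.toReal_natCast]
  rw [← Finset.mul_sum, div_eq_inv_mul, Nat.cast_succ]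

/-- The relative ranks of the first `n` observations. -/
def rankHistory (n : ℕ) (a : RankSeq) (k : Fin n) : Fin ((k : ℕ) + 1) := a k

theorem measurable_rankHistory (n : ℕ) : Measurable (rankHistory n) :=
  measurable_pi_lambda _ fun k => measurable_pi_apply (k : ℕ)

/-- Extension of a finite history by zeros. -/
def extendHistory (n : ℕ) (b : ∀ k : Fin n, Fin ((k : ℕ) + 1)) : RankSeq :=
  fun k => if h : k < n then b ⟨k, h⟩ else 0

/-- Such a function factors through the finite set of histories of length `n`; measurability and
boundedness follow at once. -/
theorem DependsOn.comp_extendHistory {β : Type*} {n : ℕ} {F : RankSeq → β}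
    (hF : DependsOn F (Set.Iio n)) :
    (fun a => F (extendHistory n (rankHistory n a))) = F := by
  ext a
  refine hF fun i hi => ?_
  simp [extendHistory, rankHistory, Set.mem_Iio.1 hi]

/-- The filtration generated by the relative ranks. -/
def rankFiltration : Filtration ℕ (inferInstance : MeasurableSpace RankSeq) where
  seq n := MeasurableSpace.comap (rankHistory n) inferInstance
  mono' m n hmn := by
    have : rankHistory m
        = (fun b (k : Fin m) => b ⟨k, k.2.trans_le hmn⟩ :
            (∀ k : Fin n, Fin ((k : ℕ) + 1)) → ∀ k : Fin m, Fin ((k : ℕ) + 1)) ∘ rankHistory n := rfl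
    simp only
    rw [this, ← MeasurableSpace.comap_comp]
    exact MeasurableSpace.comap_mono (measurable_of_finite _).comap_le
  le' n := (measurable_rankHistory n).comap_le

theorem DependsOn.measurable_rankFiltration {β : Type*} [MeasurableSpace β] {n : ℕ}
    {F : RankSeq → β} (hF : DependsOn F (Set.Iio n)) : Measurable[rankFiltration n] F := by
  rw [← hF.comp_extendHistory]
  have h1 : Measurable[rankFiltration n] (rankHistory n) := comap_measurable _
  exact (measurable_of_finite (fun b => F (extendHistory n b))).comp h1

theorem DependsOn.measurable_rankSeq {β : Type*} [MeasurableSpace β] {n : ℕ}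
    {F : RankSeq → β} (hF : DependsOn F (Set.Iio n)) : Measurable F :=
  hF.measurable_rankFiltration.mono (rankFiltration.le n) le_rfl

theorem DependsOn.integrable_rankLaw {n : ℕ} {F : RankSeq → ℝ}
    (hF : DependsOn F (Set.Iio n)) : Integrable F rankLaw := by
  obtain ⟨C, hC⟩ := (Set.finite_range fun b => |F (extendHistory n b)|).bddAbove
  refine Integrable.of_bound hF.measurable_rankSeq.aestronglyMeasurable C (.of_forall fun a => ?_)
  rw [← hF.comp_extendHistory]
  exact hC ⟨rankHistory n a, rfl⟩

/-- Doob's convergence theorem for nonnegative supermartingales, with the drift condition stated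
pointwise as a finite average. Nonnegativity and decreasing integrals supply the L¹ bound. -/
theorem exists_tendsto_of_stepMean_le {g : ℕ → RankSeq → ℝ}
    (hdep : ∀ n, DependsOn (g n) (Set.Iio n)) (h0 : ∀ n a, 0 ≤ g n a)
    (hstep : ∀ n a, stepMean n (g (n + 1)) a ≤ g n a) :
    ∀ᵐ a ∂rankLaw, ∃ l, Tendsto (fun n => g n a) atTop (𝓝 l) := by
  have hint : ∀ n, Integrable (g n) rankLaw := fun n => (hdep n).integrable_rankLaw
  have hset : ∀ n, ∀ s : Set RankSeq, MeasurableSet[rankFiltration n] s →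
      ∫ a in s, g (n + 1) a ∂rankLaw ≤ ∫ a in s, g n a ∂rankLaw := by
    rintro n s ⟨B, -, rfl⟩
    have hs : MeasurableSet (rankHistory n ⁻¹' B) :=
      measurable_rankHistory n (Set.toFinite B).measurableSet
    rw [← integral_indicator hs, ← integral_indicator hs,
      ← integral_stepMean n ((hint (n + 1)).indicator hs)]
    -- An event of the first `n` coordinates is unaffected by resampling coordinate `n`, so its
    -- indicator can be taken out of `stepMean n`.
    have hupd : ∀ a k, rankHistory n (Function.update a n k) = rankHistory n a := by
      intro a k
      funext i
      simp [rankHistory, Function.update_of_ne i.2.ne]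
    have heq : ∀ a, stepMean n ((rankHistory n ⁻¹' B).indicator (g (n + 1))) a
        = (rankHistory n ⁻¹' B).indicator (stepMean n (g (n + 1))) a := by
      intro a
      by_cases ha : rankHistory n a ∈ B
      · simp [stepMean, Set.indicator, hupd, ha]
      · simp [stepMean, Set.indicator, hupd, ha]
    have hd : DependsOn (stepMean n ((rankHistory n ⁻¹' B).indicator (g (n + 1))))
        (Set.Iio n) := by
      intro a b hab
      rw [heq, heq]
      have h1 : rankHistory n a = rankHistory n b := funext fun i => hab i i.2
      have h2 : stepMean n (g (n + 1)) a = stepMean n (g (n + 1)) b := by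
        simp only [stepMean]
        congr 1
        refine Finset.sum_congr rfl fun k _ => hdep (n + 1) fun i hi => ?_
        by_cases h : i = n
        · subst h; simp
        · rw [Function.update_of_ne h, Function.update_of_ne h]
          exact hab i (lt_of_le_of_ne (Nat.lt_succ_iff.1 hi) h)
      have h3 : a ∈ rankHistory n ⁻¹' B ↔ b ∈ rankHistory n ⁻¹' B := by
        rw [Set.mem_preimage, Set.mem_preimage, h1]
      by_cases ha : a ∈ rankHistory n ⁻¹' B
      · rw [Set.indicator_of_mem ha, Set.indicator_of_mem (h3.1 ha), h2]
      · rw [Set.indicator_of_notMem ha, Set.indicator_of_notMem (mt h3.2 ha)]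
    refine integral_mono hd.integrable_rankLaw ((hint n).indicator hs) fun a => ?_
    simp only [heq]
    exact Set.indicator_le_indicator (hstep n a)
  have hsup : Supermartingale g rankFiltration rankLaw :=
    supermartingale_of_setIntegral_succ_le
      (fun n => (hdep n).measurable_rankFiltration.stronglyMeasurable) hint hset
  have hle : ∀ n, ∫ a, g n a ∂rankLaw ≤ ∫ a, g 0 a ∂rankLaw := by
    intro n
    induction n with
    | zero => rfl
    | succ n ih =>
      refine le_trans ?_ ih
      simpa using hset n Set.univ MeasurableSet.univ
  have hb : ∀ n, eLpNorm ((-g) n) 1 rankLaw ≤ ((∫ a, g 0 a ∂rankLaw).toNNReal : ENNReal) := by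
    intro n
    rw [Pi.neg_apply, eLpNorm_neg, eLpNorm_one_eq_lintegral_enorm,
      ← ofReal_integral_norm_eq_lintegral_enorm (hint n)]
    refine ENNReal.ofReal_le_ofReal (le_trans (le_of_eq ?_) (hle n))
    exact integral_congr_ae (.of_forall fun a => by simp [abs_of_nonneg (h0 n a)])
  filter_upwards [hsup.neg.ae_tendsto_limitProcess hb] with a ha
  exact ⟨_, by simpa using ha.neg⟩

/-! ### The selection rule in terms of relative ranks -/

/-- Rank of the `i`-th observation among the first `n`, read off the relative ranks. -/
def seqRank (a : RankSeq) : ℕ → ℕ → ℕ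
  | 0, _ => 0
  | n + 1, i =>
    if i = n then (a n : ℕ) + 1 else seqRank a n i + if (a n : ℕ) < seqRank a n i then 1 else 0

/-- The retained indices, read off the relative ranks. -/
def seqRetained (r : ℕ → ℕ) (a : RankSeq) : ℕ → Finset ℕ
  | 0 => ∅
  | n + 1 =>
    if (a n : ℕ) < r (seqRetained r a n).card then insert n (seqRetained r a n)
    else seqRetained r a n

/-- The number of retained observations. -/
def seqSize (r : ℕ → ℕ) (a : RankSeq) (n : ℕ) : ℕ := (seqRetained r a n).card

/-- The sum of the ranks of the retained observations. -/
def seqSum (r : ℕ → ℕ) (a : RankSeq) (n : ℕ) : ℕ := ∑ i ∈ seqRetained r a n, seqRank a n i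

theorem seqRank_succ (a : RankSeq) (n i : ℕ) :
    seqRank a (n + 1) i = if i = n then (a n : ℕ) + 1
      else seqRank a n i + if (a n : ℕ) < seqRank a n i then 1 else 0 := rfl

theorem seqRank_dependsOn (n : ℕ) : DependsOn (fun a => seqRank a n) (Set.Iio n) := by
  induction n with
  | zero => intro a b _; rfl
  | succ n ih =>
    intro a b hab
    have h1 := ih fun i hi => hab i (Nat.lt_succ_of_lt hi)
    have h2 := hab n (Nat.lt_succ_self n)
    funext i
    simp only at h1
    simp only [seqRank, h1, h2]

theorem seqRetained_dependsOn (r : ℕ → ℕ) (n : ℕ) :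
    DependsOn (fun a => seqRetained r a n) (Set.Iio n) := by
  induction n with
  | zero => intro a b _; rfl
  | succ n ih =>
    intro a b hab
    have h1 := ih fun i hi => hab i (Nat.lt_succ_of_lt hi)
    have h2 := hab n (Nat.lt_succ_self n)
    simp only at h1
    simp only [seqRetained, h1, h2]

theorem seqSize_dependsOn (r : ℕ → ℕ) (n : ℕ) :
    DependsOn (fun a => seqSize r a n) (Set.Iio n) :=
  fun _ _ hab => congrArg Finset.card (seqRetained_dependsOn r n hab)

theorem seqSum_dependsOn (r : ℕ → ℕ) (n : ℕ) :
    DependsOn (fun a => seqSum r a n) (Set.Iio n) := by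
  intro a b hab
  have h1 := seqRetained_dependsOn r n hab
  have h2 := seqRank_dependsOn n hab
  simp only at h1 h2
  simp only [seqSum, h1, h2]

theorem update_agrees (a : RankSeq) (n : ℕ) (k : Fin (n + 1)) :
    ∀ i ∈ Set.Iio n, Function.update a n k i = a i :=
  fun _ hi => Function.update_of_ne (Set.mem_Iio.1 hi).ne _ _

theorem seqRetained_subset (r : ℕ → ℕ) (a : RankSeq) (n : ℕ) :
    seqRetained r a n ⊆ Finset.range n := by
  induction n with
  | zero => simp [seqRetained]
  | succ n ih =>
    have h := ih.trans (Finset.range_subset_range.2 n.le_succ)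
    simp only [seqRetained]
    split_ifs
    · exact Finset.insert_subset (Finset.self_mem_range_succ n) h
    · exact h

theorem notMem_seqRetained (r : ℕ → ℕ) (a : RankSeq) (n : ℕ) : n ∉ seqRetained r a n :=
  fun h => Finset.notMem_range_self (seqRetained_subset r a n h)

theorem seqSize_le (r : ℕ → ℕ) (a : RankSeq) (n : ℕ) : seqSize r a n ≤ n := by
  simpa [seqSize] using Finset.card_le_card (seqRetained_subset r a n)

theorem seqRetained_succ (r : ℕ → ℕ) (a : RankSeq) (n : ℕ) :
    seqRetained r a (n + 1) = if (a n : ℕ) < r (seqSize r a n) then insert n (seqRetained r a n)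
      else seqRetained r a n := rfl

theorem seqSize_succ (r : ℕ → ℕ) (a : RankSeq) (n : ℕ) :
    seqSize r a (n + 1) = seqSize r a n + if (a n : ℕ) < r (seqSize r a n) then 1 else 0 := by
  rw [seqSize, seqRetained_succ]
  split_ifs with h
  · rw [Finset.card_insert_of_notMem (notMem_seqRetained r a n), seqSize]
  · rfl

theorem seqRank_le (a : RankSeq) (n i : ℕ) : seqRank a n i ≤ n := by
  induction n with
  | zero => simp [seqRank]
  | succ n ih =>
    have := (a n).2
    simp only [seqRank]
    split_ifs <;> omega

theorem seqSum_succ (r : ℕ → ℕ) (a : RankSeq) (n : ℕ) :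
    seqSum r a (n + 1) = seqSum r a n
      + ∑ i ∈ seqRetained r a n, (if (a n : ℕ) < seqRank a n i then 1 else 0)
      + if (a n : ℕ) < r (seqSize r a n) then (a n : ℕ) + 1 else 0 := by
  have h : ∑ i ∈ seqRetained r a n, seqRank a (n + 1) i
      = seqSum r a n + ∑ i ∈ seqRetained r a n, (if (a n : ℕ) < seqRank a n i then 1 else 0) := by
    rw [seqSum, ← Finset.sum_add_distrib]
    refine Finset.sum_congr rfl fun i hi => ?_
    have : i ≠ n := fun h => notMem_seqRetained r a n (h ▸ hi)
    simp [seqRank, this]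
  rw [← h, seqSum, seqRetained_succ]
  split_ifs with hn
  · rw [Finset.sum_insert (notMem_seqRetained r a n), add_comm]
    simp [seqRank]
  · rfl

/-! ### Conditional means of size, rank and rank sum -/

theorem sum_fin_ite_lt {n m : ℕ} (hm : m ≤ n + 1) (φ : ℕ → ℝ) :
    ∑ k : Fin (n + 1), (if (k : ℕ) < m then φ k else 0) = ∑ k ∈ Finset.range m, φ k := by
  rw [Fin.sum_univ_eq_sum_range (fun k => if k < m then φ k else 0), ← Finset.sum_filter]
  congr 1
  ext k
  simp only [Finset.mem_filter, Finset.mem_range]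
  omega

/-- Since `r L ≤ L + 1 ≤ n + 1`, exactly `r L` of the `n + 1` equally likely relative ranks lead to
retention. -/
theorem stepMean_seqSize {r : ℕ → ℕ} (hr : ∀ k, r k ≤ k + 1) (φ : ℕ → ℝ) (n : ℕ) (a : RankSeq) :
    stepMean n (fun b => φ (seqSize r b (n + 1))) a = φ (seqSize r a n)
      + r (seqSize r a n) / ((n : ℝ) + 1) * (φ (seqSize r a n + 1) - φ (seqSize r a n)) := by
  have hL : ∀ k, seqSize r (Function.update a n k) n = seqSize r a n :=
    fun k => seqSize_dependsOn r n (update_agrees a n k)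
  set L := seqSize r a n with hLdef
  have hrL : r L ≤ n + 1 := (hr L).trans (Nat.succ_le_succ (seqSize_le r a n))
  have hterm : ∀ k : Fin (n + 1), φ (seqSize r (Function.update a n k) (n + 1))
      = φ L + if (k : ℕ) < r L then φ (L + 1) - φ L else 0 := by
    intro k
    rw [seqSize_succ, hL, Function.update_self]
    split_ifs <;> simp
  have hn : (n : ℝ) + 1 ≠ 0 := by positivity
  simp only [stepMean, hterm]
  rw [Finset.sum_add_distrib, sum_fin_ite_lt hrL fun _ => φ (L + 1) - φ L]
  simp only [Finset.sum_const, Finset.card_univ, Fintype.card_fin, Finset.card_range,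
    nsmul_eq_mul, Nat.cast_succ]
  field_simp

theorem stepMean_seqRank {n i : ℕ} (hi : i < n) (a : RankSeq) :
    stepMean n (fun b => (seqRank b (n + 1) i : ℝ)) a
      = seqRank a n i * (1 + 1 / ((n : ℝ) + 1)) := by
  have hrk : ∀ k, seqRank (Function.update a n k) n = seqRank a n :=
    fun k => seqRank_dependsOn n (update_agrees a n k)
  have hn : (n : ℝ) + 1 ≠ 0 := by positivity
  have hterm : ∀ k : Fin (n + 1), (seqRank (Function.update a n k) (n + 1) i : ℝ)
      = seqRank a n i + if (k : ℕ) < seqRank a n i then 1 else 0 := by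
    intro k
    simp only [seqRank, hrk, Function.update_self, if_neg hi.ne]
    push_cast
    rfl
  simp only [stepMean, hterm]
  rw [Finset.sum_add_distrib,
    sum_fin_ite_lt ((seqRank_le a n i).trans n.le_succ) fun _ => 1]
  simp only [Finset.sum_const, Finset.card_univ, Fintype.card_fin, Finset.card_range,
    nsmul_eq_mul, Nat.cast_succ]
  field_simp

theorem sum_range_succ_cast (m : ℕ) :
    ∑ k ∈ Finset.range m, ((k : ℝ) + 1) = (m : ℝ) * (m + 1) / 2 := by
  induction m with
  | zero => simp
  | succ m ih => rw [Finset.sum_range_succ, ih]; push_cast; ring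

/-- Each retained rank R is pushed up by one with probability R/(n+1), which contributes Q/(n+1) in
total; a retained newcomer contributes its own rank, one of 1, …, r(L). -/
theorem stepMean_seqSum {r : ℕ → ℕ} (hr : ∀ k, r k ≤ k + 1) (n : ℕ) (a : RankSeq) :
    stepMean n (fun b => (seqSum r b (n + 1) : ℝ)) a
      = seqSum r a n * (1 + 1 / ((n : ℝ) + 1))
        + (r (seqSize r a n) : ℝ) * (r (seqSize r a n) + 1) / 2 / ((n : ℝ) + 1) := by
  have hrk : ∀ k, seqRank (Function.update a n k) n = seqRank a n :=
    fun k => seqRank_dependsOn n (update_agrees a n k)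
  have hS : ∀ k, seqRetained r (Function.update a n k) n = seqRetained r a n :=
    fun k => seqRetained_dependsOn r n (update_agrees a n k)
  have hL : ∀ k, seqSize r (Function.update a n k) n = seqSize r a n :=
    fun k => seqSize_dependsOn r n (update_agrees a n k)
  have hQ : ∀ k, seqSum r (Function.update a n k) n = seqSum r a n :=
    fun k => seqSum_dependsOn r n (update_agrees a n k)
  set m := r (seqSize r a n) with hm
  have hmn : m ≤ n + 1 := (hr _).trans (Nat.succ_le_succ (seqSize_le r a n))
  have hn : (n : ℝ) + 1 ≠ 0 := by positivity
  have hterm : ∀ k : Fin (n + 1), (seqSum r (Function.update a n k) (n + 1) : ℝ)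
      = seqSum r a n + ∑ i ∈ seqRetained r a n, (if (k : ℕ) < seqRank a n i then 1 else 0)
        + if (k : ℕ) < m then (k : ℝ) + 1 else 0 := by
    intro k
    rw [seqSum_succ, hrk, hS, hL, hQ, Function.update_self, ← hm]
    push_cast
    rfl
  have hcomm : ∑ k : Fin (n + 1), ∑ i ∈ seqRetained r a n,
      (if (k : ℕ) < seqRank a n i then (1 : ℝ) else 0) = seqSum r a n := by
    rw [Finset.sum_comm, seqSum, Nat.cast_sum]
    refine Finset.sum_congr rfl fun i _ => ?_
    rw [sum_fin_ite_lt ((seqRank_le a n i).trans n.le_succ) fun _ => 1]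
    simp
  simp only [stepMean, hterm]
  rw [Finset.sum_add_distrib, Finset.sum_add_distrib, hcomm,
    sum_fin_ite_lt hmn fun k => (k : ℝ) + 1, sum_range_succ_cast]
  simp only [Finset.sum_const, Finset.card_univ, Fintype.card_fin, nsmul_eq_mul, Nat.cast_succ]
  field_simp

theorem stepMean_add (n : ℕ) (F G : RankSeq → ℝ) (a : RankSeq) :
    stepMean n (fun b => F b + G b) a = stepMean n F a + stepMean n G a := by
  simp [stepMean, Finset.sum_add_distrib, add_div]

theorem stepMean_mul_const (n : ℕ) (F : RankSeq → ℝ) (c : ℝ) (a : RankSeq) :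
    stepMean n (fun b => F b * c) a = stepMean n F a * c := by
  simp only [stepMean, ← Finset.sum_mul]
  ring

/-! ### Threshold bounds and the normalising product -/

theorem percentileThreshold_lower (p : ℝ) (k : ℕ) : p * k ≤ percentileThreshold p k := by
  unfold percentileThreshold
  split_ifs with h
  · simp [h]
  · exact Nat.le_ceil _

theorem percentileThreshold_upper {p : ℝ} (hp0 : 0 < p) (k : ℕ) :
    (percentileThreshold p k : ℝ) ≤ p * k + 1 := by
  unfold percentileThreshold
  split_ifs with h
  · simp [h]
  · exact (Nat.ceil_lt_add_one (by positivity)).le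

theorem percentileThreshold_le {p : ℝ} (hp : p ≤ 1) (k : ℕ) :
    percentileThreshold p k ≤ k + 1 := by
  unfold percentileThreshold
  split_ifs with h
  · simp
  · refine (Nat.ceil_le.2 ?_).trans k.le_succ
    nlinarith [(Nat.cast_nonneg k : (0 : ℝ) ≤ k)]

theorem percentileThreshold_zero (p : ℝ) : percentileThreshold p 0 = 1 := by
  simp [percentileThreshold]

theorem percentileThreshold_eq_one {p : ℝ} {k : ℕ} (hk : k ≠ 0) (h0 : 0 < p * k) (h1 : p * k ≤ 1) :
    percentileThreshold p k = 1 := by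
  rw [percentileThreshold, if_neg hk, Nat.ceil_eq_iff one_ne_zero]
  simpa using ⟨h0, h1⟩

/-- The growth rate of the expected number of retained observations. -/
noncomputable def growth (p : ℝ) (n : ℕ) : ℝ := ∏ k ∈ Finset.range n, (1 + p / ((k : ℝ) + 1))

theorem growth_succ (p : ℝ) (n : ℕ) : growth p (n + 1) = growth p n * (1 + p / ((n : ℝ) + 1)) :=
  Finset.prod_range_succ _ _

theorem growth_pos {p : ℝ} (hp0 : 0 < p) (n : ℕ) : 0 < growth p n :=
  Finset.prod_pos fun k _ => by positivity

/-- The quotient is the inverse of p times Euler's sequence for Γ(p). -/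
theorem tendsto_growth_div_rpow {p : ℝ} (hp0 : 0 < p) :
    Tendsto (fun n : ℕ => growth p n / (n : ℝ) ^ p) atTop (𝓝 (p * Real.Gamma p)⁻¹) := by
  have h := ((Real.GammaSeq_tendsto_Gamma p).const_mul p).inv₀
    (mul_pos hp0 (Real.Gamma_pos_of_pos hp0)).ne'
  refine h.congr fun n => ?_
  have hprod : ∏ j ∈ Finset.range (n + 1), (p + (j : ℝ))
      = p * ((n.factorial : ℝ) * growth p n) := by
    rw [Finset.prod_range_succ', Nat.cast_zero, add_zero, mul_comm, growth,
      ← Finset.prod_range_add_one_eq_factorial, Nat.cast_prod, ← Finset.prod_mul_distrib]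
    congr 1
    refine Finset.prod_congr rfl fun k _ => ?_
    have : (k : ℝ) + 1 ≠ 0 := by positivity
    push_cast
    field_simp
    ring
  have hf : (n.factorial : ℝ) ≠ 0 := by positivity
  have hg := (growth_pos hp0 n).ne'
  rw [Real.GammaSeq, hprod]
  -- When the power vanishes (at `n = 0`), both sides are 0 by the convention for division by zero.
  by_cases hz : (n : ℝ) ^ p = 0
  · simp [hz]
  · field_simp

/-! ### The three supermartingales -/

theorem ae_tendsto_seqSize_div_growth {p : ℝ} (hp0 : 0 < p) (hp : p ≤ 1) :
    ∀ᵐ a ∂rankLaw, ∃ l, Tendsto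
      (fun n => (seqSize (percentileThreshold p) a n + 1 / p) / growth p n) atTop (𝓝 l) := by
  set r := percentileThreshold p
  refine exists_tendsto_of_stepMean_le
    (fun n a b hab => by rw [show seqSize r a n = seqSize r b n from seqSize_dependsOn r n hab])
    (fun n a => div_nonneg (by positivity) (growth_pos hp0 n).le) fun n a => ?_
  have h := stepMean_seqSize (r := r) (percentileThreshold_le hp)
    (fun l => ((l : ℝ) + 1 / p) / growth p (n + 1)) n a
  rw [h]
  have hr := percentileThreshold_upper hp0 (seqSize r a n)
  have hg := growth_pos hp0 n
  set L : ℝ := (seqSize r a n : ℝ)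
  rw [growth_succ]
  have hn : (0 : ℝ) < n + 1 := by positivity
  have hx : 0 < 1 + p / ((n : ℝ) + 1) := by positivity
  rw [Nat.cast_succ]
  have e : (L + 1 / p) / (growth p n * (1 + p / ((n : ℝ) + 1)))
      + (r (seqSize r a n) : ℝ) / ((n : ℝ) + 1)
        * ((L + 1 + 1 / p) / (growth p n * (1 + p / ((n : ℝ) + 1)))
          - (L + 1 / p) / (growth p n * (1 + p / ((n : ℝ) + 1))))
      = ((L + 1 / p) + (r (seqSize r a n) : ℝ) / ((n : ℝ) + 1))
        / (growth p n * (1 + p / ((n : ℝ) + 1))) := by ring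
  rw [e, div_le_div_iff₀ (by positivity) hg]
  have h2 : (r (seqSize r a n) : ℝ) / ((n : ℝ) + 1) ≤ (L + 1 / p) * (p / ((n : ℝ) + 1)) := by
    rw [mul_div_assoc', div_le_div_iff_of_pos_right hn]
    refine hr.trans (le_of_eq ?_)
    field_simp
  nlinarith [mul_le_mul_of_nonneg_right h2 hg.le]

/-- A Lyapunov function of the number of retained observations, comparable with its inverse. -/
noncomputable def sizeWeight : ℕ → ℝ
  | 0 => 4
  | 1 => 2
  | k + 2 => 1 / ((k : ℝ) + 1)

theorem sizeWeight_pos (k : ℕ) : 0 < sizeWeight k := by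
  match k with
  | 0 => simp [sizeWeight]
  | 1 => simp [sizeWeight]
  | k + 2 => simp only [sizeWeight]; positivity

/-- For k ≥ 2 the weight 1/(k-1) drops by 1/((k-1)k), and r(k) ≥ pk suffices exactly. The values 4
and 2 at k = 0, 1 halve at each step, so there r(k) = 1 and 2p ≤ 1 suffice. -/
theorem sizeWeight_drift {p : ℝ} (hp0 : 0 < p) (hp : p < 1 / 2) (k : ℕ) :
    p * sizeWeight k ≤ percentileThreshold p k * (sizeWeight k - sizeWeight (k + 1)) := by
  match k with
  | 0 =>
    rw [percentileThreshold_zero]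
    norm_num [sizeWeight]
    linarith
  | 1 =>
    rw [percentileThreshold_eq_one one_ne_zero (by simpa) (by norm_num; linarith)]
    norm_num [sizeWeight]
    linarith
  | k + 2 =>
    have h := percentileThreshold_lower p (k + 2)
    set t : ℝ := (percentileThreshold p (k + 2) : ℝ)
    have e : sizeWeight (k + 2) - sizeWeight (k + 2 + 1)
        = 1 / (((k : ℝ) + 1) * ((k : ℝ) + 2)) := by
      simp only [sizeWeight]
      push_cast
      field_simp
      ring
    rw [e]
    simp only [sizeWeight]
    push_cast at h
    rw [mul_one_div, mul_one_div, div_le_div_iff₀ (by positivity) (by positivity)]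
    nlinarith [mul_le_mul_of_nonneg_right h (by positivity : (0 : ℝ) ≤ (k : ℝ) + 1)]

theorem one_le_add_mul_sizeWeight {c : ℝ} (hc : 1 ≤ c) (k : ℕ) : 1 ≤ (k + c) * sizeWeight k := by
  match k with
  | 0 => norm_num [sizeWeight]; linarith
  | 1 => norm_num [sizeWeight]; linarith
  | k + 2 =>
    simp only [sizeWeight]
    push_cast
    rw [mul_one_div, le_div_iff₀ (by positivity)]
    linarith

theorem ae_tendsto_sizeWeight_mul_growth {p : ℝ} (hp0 : 0 < p) (hp : p < 1 / 2) :
    ∀ᵐ a ∂rankLaw, ∃ l, Tendsto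
      (fun n => sizeWeight (seqSize (percentileThreshold p) a n) * growth p n) atTop (𝓝 l) := by
  set r := percentileThreshold p
  refine exists_tendsto_of_stepMean_le
    (fun n a b hab => by rw [show seqSize r a n = seqSize r b n from seqSize_dependsOn r n hab])
    (fun n a => mul_nonneg (sizeWeight_pos _).le (growth_pos hp0 n).le) fun n a => ?_
  have h := stepMean_seqSize (r := r) (percentileThreshold_le (by linarith))
    (fun l => sizeWeight l * growth p (n + 1)) n a
  rw [h, growth_succ]
  have hd := sizeWeight_drift hp0 hp (seqSize r a n)
  have hg := growth_pos hp0 n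
  have hw := sizeWeight_pos (seqSize r a n)
  set L := seqSize r a n
  have hx : 0 < 1 / ((n : ℝ) + 1) := by positivity
  set x := 1 / ((n : ℝ) + 1) with hxdef
  have h1 : sizeWeight L - x * (r L * (sizeWeight L - sizeWeight (L + 1)))
      ≤ sizeWeight L * (1 - p * x) := by
    nlinarith [mul_le_mul_of_nonneg_left hd hx.le]
  have e : sizeWeight L * (growth p n * (1 + p / ((n : ℝ) + 1)))
      + (r L : ℝ) / ((n : ℝ) + 1)
        * (sizeWeight (L + 1) * (growth p n * (1 + p / ((n : ℝ) + 1)))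
          - sizeWeight L * (growth p n * (1 + p / ((n : ℝ) + 1))))
      = (sizeWeight L - x * (r L * (sizeWeight L - sizeWeight (L + 1)))) * (1 + p * x)
        * growth p n := by
    rw [hxdef]; ring
  rw [e]
  refine mul_le_mul_of_nonneg_right ?_ hg.le
  -- The decay factor 1 - px of the weight beats the growth factor: (1 - px)(1 + px) ≤ 1.
  have h2 := mul_le_mul_of_nonneg_right h1 (by positivity : 0 ≤ 1 + p * x)
  nlinarith [mul_nonneg hw.le (sq_nonneg (p * x))]

theorem ae_tendsto_seqSum_add {p : ℝ} (hp0 : 0 < p) (hp : p < 1 / 2) :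
    ∀ᵐ a ∂rankLaw, ∃ l, Tendsto (fun n : ℕ =>
      (seqSum (percentileThreshold p) a n : ℝ) * (1 / ((n : ℝ) + 1))
        + p ^ 2 / (1 - 2 * p) * ((seqSize (percentileThreshold p) a n + 1 / p)
          * (seqSize (percentileThreshold p) a n + 1 / p + 1)) * (1 / ((n : ℝ) + 1)))
      atTop (𝓝 l) := by
  set r := percentileThreshold p
  have hp2 : 0 < 1 - 2 * p := by linarith
  refine exists_tendsto_of_stepMean_le
    (fun n a b hab => by
      rw [show seqSize r a n = seqSize r b n from seqSize_dependsOn r n hab,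
        show seqSum r a n = seqSum r b n from seqSum_dependsOn r n hab])
    (fun n a => by positivity) fun n a => ?_
  have hr : ∀ k, r k ≤ k + 1 := percentileThreshold_le (by linarith)
  -- K solves p² + 2pK = K: the drift p² from the rank sum and 2pK from the correction's growth are
  -- balanced by the K lost when the denominator grows by one.
  set K := p ^ 2 / (1 - 2 * p) with hK
  rw [stepMean_add, stepMean_mul_const, stepMean_seqSum hr, stepMean_mul_const,
    stepMean_seqSize hr (fun l => K * (((l : ℝ) + 1 / p) * ((l : ℝ) + 1 / p + 1)))]
  have hru := percentileThreshold_upper hp0 (seqSize r a n)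
  set L : ℝ := (seqSize r a n : ℝ) with hL
  set y : ℝ := L + 1 / p with hy
  have hpy : p * L + 1 = p * y := by rw [hy]; field_simp
  have hpy1 : 1 ≤ p * y := by
    rw [← hpy]
    have : 0 ≤ p * L := by positivity
    linarith
  have hy0 : 0 < y := by positivity
  set t : ℝ := (r (seqSize r a n) : ℝ) with ht
  have ht0 : 0 ≤ t := by positivity
  have hty : t ≤ p * y := hpy ▸ hru
  have hK0 : 0 ≤ K := by positivity
  have hKp : p ^ 2 + K * (2 * p) = K := by
    have h : K * (1 - 2 * p) = p ^ 2 := div_mul_cancel₀ _ hp2.ne'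
    linarith
  have h1 : t * (t + 1) / 2 ≤ p ^ 2 * (y * (y + 1)) := by nlinarith
  have h2 : t * (2 * (y + 1)) ≤ 2 * p * (y * (y + 1)) := by nlinarith
  have hn : (0 : ℝ) < n + 1 := by positivity
  set Q : ℝ := (seqSum r a n : ℝ)
  push_cast
  have e1 : (Q * (1 + 1 / ((n : ℝ) + 1)) + t * (t + 1) / 2 / ((n : ℝ) + 1))
        * (1 / ((n : ℝ) + 1 + 1))
      + (K * (y * (y + 1)) + t / ((n : ℝ) + 1)
        * (K * ((L + 1 + 1 / p) * (L + 1 + 1 / p + 1)) - K * (y * (y + 1))))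
        * (1 / ((n : ℝ) + 1 + 1))
      = Q * (1 / ((n : ℝ) + 1)) + (t * (t + 1) / 2 + K * (t * (2 * (y + 1)))
          + K * (y * (y + 1)) * ((n : ℝ) + 1)) * (1 / (((n : ℝ) + 1) * ((n : ℝ) + 1 + 1))) := by
    have : L + 1 + 1 / p = y + 1 := by rw [hy]; ring
    rw [this]
    field_simp
    ring
  have e2 : K * (y * (y + 1)) * (1 / ((n : ℝ) + 1))
      = (K * (y * (y + 1)) * ((n : ℝ) + 1 + 1)) * (1 / (((n : ℝ) + 1) * ((n : ℝ) + 1 + 1))) := by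
    field_simp
  rw [e1, e2]
  refine add_le_add le_rfl (mul_le_mul_of_nonneg_right ?_ (by positivity))
  have h3 := mul_le_mul_of_nonneg_left h2 hK0
  have h4 : (p ^ 2 + K * (2 * p)) * (y * (y + 1)) = K * (y * (y + 1)) := by rw [hKp]
  linarith

/-! ### Almost sure limits of size, rank sum and average rank -/

theorem tendsto_growth_atTop {p : ℝ} (hp0 : 0 < p) : Tendsto (growth p) atTop atTop := by
  have h1 := (tendsto_rpow_atTop hp0).comp tendsto_natCast_atTop_atTop
  have h2 := h1.atTop_mul_pos (inv_pos.2 (mul_pos hp0 (Real.Gamma_pos_of_pos hp0)))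
    (tendsto_growth_div_rpow hp0)
  refine h2.congr' ?_
  filter_upwards [eventually_gt_atTop 0] with n hn
  have : (0 : ℝ) < (n : ℝ) ^ p := by positivity
  simp only [Function.comp_apply]
  field_simp

theorem tendsto_growth_sq_div {p : ℝ} (hp0 : 0 < p) (hp : p < 1 / 2) :
    Tendsto (fun n : ℕ => growth p n ^ 2 / ((n : ℝ) + 1)) atTop (𝓝 0) := by
  have h1 := (tendsto_growth_div_rpow hp0).pow 2
  have h2 : Tendsto (fun n : ℕ => (n : ℝ) ^ (-(1 - 2 * p))) atTop (𝓝 0) :=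
    (tendsto_rpow_neg_atTop (by linarith)).comp tendsto_natCast_atTop_atTop
  have h3 : Tendsto (fun n : ℕ => (n : ℝ) / ((n : ℝ) + 1)) atTop (𝓝 1) :=
    tendsto_natCast_div_add_atTop 1
  have h := (h1.mul h2).mul h3
  rw [mul_zero, zero_mul] at h
  refine h.congr' ?_
  filter_upwards [eventually_gt_atTop 0] with n hn
  have hn' : (0 : ℝ) < n := by exact_mod_cast hn
  have hz : (0 : ℝ) < (n : ℝ) ^ p := by positivity
  have e : (n : ℝ) ^ (-(1 - 2 * p)) = ((n : ℝ) ^ p) ^ 2 / n := by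
    rw [neg_sub, Real.rpow_sub hn', Real.rpow_one, mul_comm, Real.rpow_mul hn'.le]
    norm_num
  rw [e]
  field_simp

theorem ae_tendsto_seqSize_seqSum {p : ℝ} (hp0 : 0 < p) (hp : p < 1 / 2) :
    ∀ᵐ a ∂rankLaw, ∃ w q : ℝ, 0 < w ∧
      Tendsto (fun n : ℕ => (seqSize (percentileThreshold p) a n : ℝ) / (n : ℝ) ^ p)
        atTop (𝓝 w) ∧
      Tendsto (fun n : ℕ => (seqSum (percentileThreshold p) a n : ℝ) / ((n : ℝ) + 1))
        atTop (𝓝 q) := by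
  filter_upwards [ae_tendsto_seqSize_div_growth hp0 (by linarith),
    ae_tendsto_sizeWeight_mul_growth hp0 hp, ae_tendsto_seqSum_add hp0 hp] with a ⟨u, hu⟩ ⟨z, hz⟩
    ⟨v, hv⟩
  set L := seqSize (percentileThreshold p) a
  set Q := seqSum (percentileThreshold p) a
  have hg := tendsto_growth_atTop hp0
  have hinv : Tendsto (fun n => (growth p n)⁻¹) atTop (𝓝 0) := tendsto_inv_atTop_zero.comp hg
  have hu0 : 0 ≤ u := ge_of_tendsto' hu fun n =>
    div_nonneg (by positivity) (growth_pos hp0 n).le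
  -- The growth factors cancel in the product of the two supermartingales, leaving (L + 1/p) times
  -- the weight of L, which is at least 1. Hence u cannot be 0.
  have huz : 1 ≤ u * z := by
    refine ge_of_tendsto' (hu.mul hz) fun n => ?_
    have hgn := (growth_pos hp0 n).ne'
    have := one_le_add_mul_sizeWeight (c := 1 / p) (by rw [le_div_iff₀ hp0]; linarith) (L n)
    calc (1 : ℝ) ≤ (L n + 1 / p) * sizeWeight (L n) := this
      _ = _ := by field_simp
  have hupos : 0 < u := hu0.lt_of_ne (by rintro rfl; norm_num at huz)
  have hC : 0 < (p * Real.Gamma p)⁻¹ := inv_pos.2 (mul_pos hp0 (Real.Gamma_pos_of_pos hp0))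
  refine ⟨u * (p * Real.Gamma p)⁻¹, v, mul_pos hupos hC, ?_, ?_⟩
  · have h := (hu.sub (hinv.const_mul (1 / p))).mul (tendsto_growth_div_rpow hp0)
    rw [mul_zero, sub_zero] at h
    refine h.congr fun n => ?_
    have hgn := (growth_pos hp0 n).ne'
    field_simp
    ring
  · have h1 := (hu.pow 2).mul (tendsto_growth_sq_div hp0 hp)
    have h2 := (hu.mul hinv).mul (tendsto_growth_sq_div hp0 hp)
    have h := hv.sub ((h1.add h2).const_mul (p ^ 2 / (1 - 2 * p)))
    simp only [mul_zero, add_zero, sub_zero] at h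
    refine h.congr fun n => ?_
    have hgn := (growth_pos hp0 n).ne'
    have e : (((L n : ℝ) + 1 / p) / growth p n) ^ 2 * (growth p n ^ 2 / ((n : ℝ) + 1))
        + (((L n : ℝ) + 1 / p) / growth p n) * (growth p n)⁻¹ * (growth p n ^ 2 / ((n : ℝ) + 1))
        = ((L n : ℝ) + 1 / p) * ((L n : ℝ) + 1 / p + 1) * (1 / ((n : ℝ) + 1)) := by
      field_simp
    rw [e]
    ring

theorem ae_tendsto_seqSum_div_seqSize {p : ℝ} (hp0 : 0 < p) (hp : p < 1 / 2) :
    ∀ᵐ a ∂rankLaw, ∃ l : ℝ, Tendsto (fun n : ℕ =>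
      (seqSum (percentileThreshold p) a n : ℝ) / (seqSize (percentileThreshold p) a n : ℝ)
        / (n : ℝ) ^ (1 - p)) atTop (𝓝 l) := by
  filter_upwards [ae_tendsto_seqSize_seqSum hp0 hp] with a ⟨w, q, hw, hL, hQ⟩
  have h3 : Tendsto (fun n : ℕ => ((n : ℝ) / ((n : ℝ) + 1))⁻¹) atTop (𝓝 (1 : ℝ)⁻¹) :=
    (tendsto_natCast_div_add_atTop (1 : ℝ)).inv₀ one_ne_zero
  refine ⟨_, ((hQ.mul h3).div hL hw.ne').congr' ?_⟩
  filter_upwards [eventually_gt_atTop 0] with n hn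
  have hn' : (0 : ℝ) < n := by exact_mod_cast hn
  have hz : (0 : ℝ) < (n : ℝ) ^ p := by positivity
  rw [Real.rpow_sub hn', Real.rpow_one]
  simp only [Pi.div_apply]
  field_simp

/-! ### Nondegeneracy by a measure-preserving exchange -/

theorem map_uniformOn_univ_perm (n : ℕ) (e : Equiv.Perm (Fin (n + 1))) :
    (uniformOn (Set.univ : Set (Fin (n + 1)))).map e = uniformOn Set.univ := by
  refine Measure.ext_of_singleton fun k => ?_
  have h : e ⁻¹' {k} = {e.symm k} := by
    ext j
    simp [Equiv.eq_symm_apply]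
  rw [Measure.map_apply (measurable_of_finite e) (measurableSet_singleton k), h,
    uniformOn_univ_fin_singleton, uniformOn_univ_fin_singleton]

/-- The permutation of the possible relative ranks that exchanges the two largest values of the
third relative rank. -/
def thirdRankPerm : ∀ n : ℕ, Equiv.Perm (Fin (n + 1))
  | 2 => Equiv.swap 1 2
  | _ => Equiv.refl _

/-- Exchange of the two largest values of the third relative rank. -/
def swapThird (a : RankSeq) : RankSeq := fun n => thirdRankPerm n (a n)

theorem measurePreserving_swapThird : MeasurePreserving swapThird rankLaw rankLaw := by
  have hf : ∀ n, Measurable (thirdRankPerm n) := fun n => measurable_of_finite _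
  refine ⟨measurable_pi_lambda _ fun n => (hf n).comp (measurable_pi_apply n), ?_⟩
  have h := Measure.infinitePi_map_pi
    (μ := fun n => uniformOn (Set.univ : Set (Fin (n + 1)))) (f := fun n => thirdRankPerm n) hf
  simp only [map_uniformOn_univ_perm] at h
  exact h

theorem swapThird_apply {n : ℕ} (hn : n ≠ 2) (a : RankSeq) : swapThird a n = a n := by
  match n, hn with
  | 0, _ => rfl
  | 1, _ => rfl
  | n + 3, _ => rfl

theorem swapThird_update {n : ℕ} (hn : n ≠ 2) (a : RankSeq) (k : Fin (n + 1)) :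
    swapThird (Function.update a n k) = Function.update (swapThird a) n k := by
  funext i
  by_cases h : i = n
  · subst h
    rw [swapThird_apply hn, Function.update_self, Function.update_self]
  · simp only [swapThird, Function.update_of_ne h]

/-- The event that the second observation is the smallest and the third is the median of the
first three. -/
def medianThird : Set RankSeq := {a | a 1 = 0 ∧ a 2 = 1}

theorem measurableSet_medianThird : MeasurableSet medianThird := by
  have h (n : ℕ) (k : Fin (n + 1)) : MeasurableSet {a : RankSeq | a n = k} :=
    (measurable_pi_apply n : Measurable fun a : RankSeq => a n) (measurableSet_singleton k)
  exact (h 1 0).inter (h 2 1)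

theorem rankLaw_cylinder (N : ℕ) (c : RankSeq) :
    rankLaw (Set.pi (Finset.range N) fun i => {c i}) = ((N.factorial : ℕ) : ENNReal)⁻¹ := by
  rw [rankLaw, Measure.infinitePi_pi _ fun i _ => measurableSet_singleton _]
  simp only [uniformOn_univ_fin_singleton]
  induction N with
  | zero => simp
  | succ N ih =>
    rw [Finset.prod_range_succ, ih, Nat.factorial_succ, mul_comm, Nat.cast_mul,
      ENNReal.mul_inv (by simp) (by simp)]

theorem rankLaw_real_medianThird_pos : 0 < rankLaw.real medianThird := by
  refine ENNReal.toReal_pos (fun h0 => ?_) (measure_ne_top _ _)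
  -- With truncated subtraction the prescribed relative ranks are 0, 0, 1.
  have h := rankLaw_cylinder 3 fun i => Fin.ofNat (i + 1) (i - 1)
  have hsub : Set.pi (Finset.range 3) (fun i => {Fin.ofNat (i + 1) (i - 1)}) ⊆ medianThird :=
    fun a ha => ⟨ha 1 (by simp), ha 2 (by simp)⟩
  rw [measure_mono_null hsub h0] at h
  exact (ENNReal.inv_ne_zero.2 (ENNReal.natCast_ne_top _)) h.symm

theorem swapThird_two {a : RankSeq} (ha : a ∈ medianThird) : swapThird a 2 = 2 := by
  simp only [swapThird, thirdRankPerm, ha.2]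
  exact Equiv.swap_apply_left _ _

theorem seqRank_three {a : RankSeq} (ha : a ∈ medianThird) :
    seqRank a 3 0 = 3 ∧ seqRank (swapThird a) 3 0 = 2 := by
  have h2 := swapThird_two ha
  have h1 : swapThird a 1 = 0 := (swapThird_apply (by norm_num) a).trans ha.1
  have h0 : ∀ b : RankSeq, b 0 = 0 :=
    fun b => Fin.ext (Nat.lt_one_iff.1 (b 0).2)
  constructor
  · simp [seqRank, ha.1, ha.2, h0 a]
  · simp [seqRank, h1, h2, h0 (swapThird a)]

/-- The third observation is rejected before and after the exchange because its relative rank, 1 or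
2, is not below `r 2 = 1`. Later decisions use only the retained size and unchanged relative ranks,
so the two runs never diverge. -/
theorem swapThird_invariants {r : ℕ → ℕ} (h0 : r 0 = 1) (h1 : r 1 = 1) (h2 : r 2 = 1)
    {a : RankSeq} (ha : a ∈ medianThird) (n : ℕ) :
    seqRetained r (swapThird a) (n + 3) = seqRetained r a (n + 3)
      ∧ 0 ∈ seqRetained r a (n + 3) ∧ 2 ∉ seqRetained r a (n + 3)
      ∧ ∀ i, i ≠ 0 → i ≠ 2 → seqRank (swapThird a) (n + 3) i = seqRank a (n + 3) i := by
  induction n with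
  | zero =>
    have s2 := swapThird_two ha
    have s1 : swapThird a 1 = 0 := (swapThird_apply (by norm_num) a).trans ha.1
    have s0 : ∀ b : RankSeq, b 0 = 0 :=
    fun b => Fin.ext (Nat.lt_one_iff.1 (b 0).2)
    have e1 : seqRetained r a 3 = {0, 1} := by
      simp [seqRetained, h0, h1, h2, ha.1, ha.2, s0 a, Finset.pair_comm]
    have e2 : seqRetained r (swapThird a) 3 = {0, 1} := by
      simp [seqRetained, h0, h1, h2, s1, s2, s0 (swapThird a), Finset.pair_comm]
    refine ⟨by rw [e1, e2], by simp [e1], by simp [e1], fun i hi0 hi2 => ?_⟩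
    by_cases hi : i = 1
    · subst hi
      simp [seqRank, s1, s2, ha.1, ha.2]
    -- Indices not yet observed have rank 0 in both sequences.
    · simp [seqRank, hi, hi0, hi2]
  | succ n ih =>
    obtain ⟨i1, i2, i3, i4⟩ := ih
    have hn : swapThird a (n + 3) = a (n + 3) := swapThird_apply (by omega) a
    refine ⟨?_, ?_, ?_, fun i hi0 hi2 => ?_⟩
    · have hs : seqSize r (swapThird a) (n + 3) = seqSize r a (n + 3) := congrArg Finset.card i1
      rw [seqRetained_succ r _ (n + 3), seqRetained_succ r _ (n + 3), hs, i1, hn]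
    · rw [seqRetained_succ]
      split_ifs
      · exact Finset.mem_insert_of_mem i2
      · exact i2
    · rw [seqRetained_succ]
      split_ifs
      · rw [Finset.mem_insert]
        rintro (h | h)
        · omega
        · exact i3 h
      · exact i3
    · rw [seqRank_succ _ (n + 3), seqRank_succ _ (n + 3), hn, i4 i hi0 hi2]

/-- The change in the rank of the first observation caused by `swapThird`. -/
noncomputable def rankGap (n : ℕ) (a : RankSeq) : ℝ := seqRank a n 0 - seqRank (swapThird a) n 0

theorem seqSum_sub_seqSum_swapThird {r : ℕ → ℕ} (h0 : r 0 = 1) (h1 : r 1 = 1) (h2 : r 2 = 1)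
    {a : RankSeq} (ha : a ∈ medianThird) (n : ℕ) :
    (seqSum r a (n + 3) : ℝ) - seqSum r (swapThird a) (n + 3) = rankGap (n + 3) a := by
  obtain ⟨i1, i2, i3, i4⟩ := swapThird_invariants h0 h1 h2 ha n
  rw [seqSum, seqSum, i1, Nat.cast_sum, Nat.cast_sum, ← Finset.sum_sub_distrib,
    Finset.sum_eq_single_of_mem 0 i2, rankGap]
  intro i hi hi0
  rw [i4 i hi0 (fun h => i3 (h ▸ hi)), sub_self]

theorem rankGap_dependsOn (n : ℕ) : DependsOn (rankGap n) (Set.Iio n) := by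
  intro a b hab
  have e1 := seqRank_dependsOn n hab
  have e2 := seqRank_dependsOn n (x := swapThird a) (y := swapThird b)
    fun i hi => by simp only [swapThird, hab i hi]
  simp only at e1 e2
  simp only [rankGap, e1, e2]

theorem abs_rankGap_le (n : ℕ) (a : RankSeq) : |rankGap n a| ≤ n := by
  have e1 : (seqRank a n 0 : ℝ) ≤ n := by exact_mod_cast seqRank_le a n 0
  have e2 : (seqRank (swapThird a) n 0 : ℝ) ≤ n := by
    exact_mod_cast seqRank_le (swapThird a) n 0
  rw [rankGap, abs_le]
  constructor <;> linarith [(Nat.cast_nonneg (seqRank a n 0) : (0 : ℝ) ≤ _),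
    (Nat.cast_nonneg (seqRank (swapThird a) n 0) : (0 : ℝ) ≤ _)]

theorem stepMean_rankGap (n : ℕ) (a : RankSeq) :
    stepMean (n + 3) (rankGap (n + 4)) a
      = rankGap (n + 3) a * (1 + 1 / (((n + 3 : ℕ) : ℝ) + 1)) := by
  have e : stepMean (n + 3) (rankGap (n + 4)) a
      = stepMean (n + 3) (fun b => (seqRank b (n + 4) 0 : ℝ)) a
        - stepMean (n + 3) (fun b => (seqRank b (n + 4) 0 : ℝ)) (swapThird a) := by
    simp only [stepMean, rankGap, swapThird_update (show n + 3 ≠ 2 by omega),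
      Finset.sum_sub_distrib, sub_div]
  rw [e, stepMean_seqRank (by omega), stepMean_seqRank (by omega), rankGap]
  ring

theorem integrable_indicator_rankGap (n : ℕ) :
    Integrable (medianThird.indicator (rankGap n)) rankLaw :=
  (rankGap_dependsOn n).integrable_rankLaw.indicator measurableSet_medianThird

/-- On the event the gap starts at 3 - 2 = 1. Each step multiplies its mean by 1 + 1/(n+4) =
(n+5)/(n+4), and the product telescopes. -/
theorem integral_indicator_rankGap (n : ℕ) :
    ∫ a, medianThird.indicator (rankGap (n + 3)) a ∂rankLaw
      = ((n : ℝ) + 4) / 4 * rankLaw.real medianThird := by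
  induction n with
  | zero =>
    have e : medianThird.indicator (rankGap 3) = medianThird.indicator fun _ => (1 : ℝ) := by
      refine Set.indicator_congr fun a ha => ?_
      rw [rankGap, (seqRank_three ha).1, (seqRank_three ha).2]
      norm_num
    rw [zero_add, e, integral_indicator measurableSet_medianThird]
    simp
  | succ n ih =>
    rw [← integral_stepMean (n + 3) (integrable_indicator_rankGap (n + 1 + 3))]
    have e : ∀ a, stepMean (n + 3) (medianThird.indicator (rankGap (n + 1 + 3))) a
        = medianThird.indicator (rankGap (n + 3)) a * (1 + 1 / (((n + 3 : ℕ) : ℝ) + 1)) := by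
      intro a
      have hm : ∀ k, Function.update a (n + 3) k ∈ medianThird ↔ a ∈ medianThird := by
        intro k
        simp only [medianThird, Set.mem_ofPred_eq]
        rw [Function.update_of_ne (by omega), Function.update_of_ne (by omega)]
      by_cases ha : a ∈ medianThird
      · rw [Set.indicator_of_mem ha, ← stepMean_rankGap]
        simp only [stepMean]
        congr 1
        exact Finset.sum_congr rfl fun k _ => Set.indicator_of_mem ((hm k).2 ha) _
      · rw [Set.indicator_of_notMem ha, zero_mul, stepMean,
          Finset.sum_eq_zero fun k _ => Set.indicator_of_notMem (mt (hm k).1 ha) _, zero_div]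
    simp only [e]
    rw [integral_mul_const, ih]
    push_cast
    field_simp
    ring

theorem not_ae_tendsto_const {p : ℝ} (hp0 : 0 < p) (hp : p < 1 / 2) (c : ℝ) :
    ¬ ∀ᵐ a ∂rankLaw, Tendsto (fun n : ℕ =>
      (seqSum (percentileThreshold p) a n : ℝ) / (seqSize (percentileThreshold p) a n : ℝ)
        / (n : ℝ) ^ (1 - p)) atTop (𝓝 c) := by
  intro hc
  set r := percentileThreshold p
  have r0 : r 0 = 1 := percentileThreshold_zero p
  have r1 : r 1 = 1 := percentileThreshold_eq_one one_ne_zero (by simpa) (by norm_num; linarith)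
  have r2 : r 2 = 1 := percentileThreshold_eq_one two_ne_zero (by simpa) (by norm_num; linarith)
  have hc' := measurePreserving_swapThird.quasiMeasurePreserving.ae hc
  have hlim : ∀ᵐ a ∂rankLaw, Tendsto (fun n : ℕ =>
      medianThird.indicator (rankGap (n + 3)) a / ((n + 3 : ℕ) : ℝ)) atTop (𝓝 0) := by
    filter_upwards [hc, hc', ae_tendsto_seqSize_seqSum hp0 hp] with a h1 h2 ⟨w, q, _, hw, _⟩
    have hw : Tendsto (fun n : ℕ => (seqSize r a n : ℝ) / (n : ℝ) ^ p) atTop (𝓝 w) := hw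
    by_cases ha : a ∈ medianThird
    · have h := ((h1.sub h2).mul hw).comp (tendsto_add_atTop_nat 3)
      rw [sub_self, zero_mul] at h
      refine h.congr fun n => ?_
      obtain ⟨i1, i2, -, -⟩ := swapThird_invariants r0 r1 r2 ha n
      have hL : (seqSize r a (n + 3) : ℝ) ≠ 0 := by
        rw [Nat.cast_ne_zero]
        exact Finset.card_ne_zero_of_mem i2
      have hn : (0 : ℝ) < ((n + 3 : ℕ) : ℝ) := by positivity
      have hz : (0 : ℝ) < ((n + 3 : ℕ) : ℝ) ^ p := by positivity
      have hs : seqSize r (swapThird a) (n + 3) = seqSize r a (n + 3) := congrArg Finset.card i1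
      rw [Set.indicator_of_mem ha, ← seqSum_sub_seqSum_swapThird r0 r1 r2 ha]
      simp only [Function.comp_apply]
      rw [hs, Real.rpow_sub hn, Real.rpow_one]
      field_simp
    · simp [Set.indicator_of_notMem ha]
  have hint := tendsto_integral_of_dominated_convergence (fun _ => (1 : ℝ))
    (fun n => ((integrable_indicator_rankGap (n + 3)).div_const _).aestronglyMeasurable)
    (integrable_const _) (fun n => .of_forall fun a => ?_) hlim
  · have hpos := rankLaw_real_medianThird_pos
    rw [integral_zero] at hint
    have : rankLaw.real medianThird / 4 ≤ 0 := by
      refine ge_of_tendsto' hint fun n => ?_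
      rw [integral_div, integral_indicator_rankGap, le_div_iff₀ (by positivity)]
      push_cast
      nlinarith
    linarith
  · rw [Real.norm_eq_abs, abs_div, Nat.abs_cast, div_le_one (by positivity)]
    refine le_trans ?_ (abs_rankGap_le (n + 3) a)
    by_cases ha : a ∈ medianThird
    · rw [Set.indicator_of_mem ha]
    · rw [Set.indicator_of_notMem ha, abs_zero]
      exact abs_nonneg _

/-! ### From observations to relative ranks -/

theorem obsRank_mono (x : ℕ → ℝ) (n : ℕ) {i j : ℕ} (h : x i ≤ x j) :
    obsRank x n i ≤ obsRank x n j :=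
  Finset.card_le_card fun k hk => by
    rw [Finset.mem_filter] at hk ⊢
    exact ⟨hk.1, hk.2.trans h⟩

theorem obsRank_strictMono (x : ℕ → ℝ) {n i j : ℕ} (hj : j < n) (h : x i < x j) :
    obsRank x n i < obsRank x n j := by
  refine Finset.card_lt_card ⟨fun k hk => ?_, fun hsub => ?_⟩
  · rw [Finset.mem_filter] at hk ⊢
    exact ⟨hk.1, hk.2.trans h.le⟩
  · have := hsub (Finset.mem_filter.2 ⟨Finset.mem_range.2 hj, le_rfl⟩)
    exact h.not_ge (Finset.mem_filter.1 this).2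

theorem obsRank_lt_iff (x : ℕ → ℝ) {n i j : ℕ} (hj : j < n) :
    obsRank x n i < obsRank x n j ↔ x i < x j :=
  ⟨fun h => lt_of_not_ge fun hle => h.not_ge (obsRank_mono x n hle), obsRank_strictMono x hj⟩

theorem obsRank_succ (x : ℕ → ℝ) (n i : ℕ) :
    obsRank x (n + 1) i = obsRank x n i + if x n ≤ x i then 1 else 0 := by
  rw [obsRank, obsRank, Finset.range_add_one, Finset.filter_insert]
  split_ifs
  · rw [Finset.card_insert_of_notMem (by simp)]
  · rfl

theorem obsRank_succ_self (x : ℕ → ℝ) (n : ℕ) : obsRank x (n + 1) n = obsRank x n n + 1 := by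
  rw [obsRank_succ, if_pos le_rfl]

theorem obsRank_le (x : ℕ → ℝ) (n i : ℕ) : obsRank x n i ≤ n :=
  (Finset.card_filter_le _ _).trans (Finset.card_range n).le

/-- The relative ranks, counted from zero, of a sequence of observations. -/
noncomputable def relRanks (x : ℕ → ℝ) : RankSeq :=
  fun n => ⟨obsRank x n n, Nat.lt_succ_of_le (obsRank_le x n n)⟩

/-- The newcomer's relative rank is below the rank of `i` exactly when `x n < x i`, whereas
`obsRank` counts `x n ≤ x i`; injectivity reconciles the two. -/
theorem seqRank_relRanks {x : ℕ → ℝ} (hx : Function.Injective x) {n i : ℕ} (hi : i < n) :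
    seqRank (relRanks x) n i = obsRank x n i := by
  induction n with
  | zero => omega
  | succ n ih =>
    rw [seqRank]
    split_ifs with h
    · rw [h, obsRank_succ_self]
      rfl
    all_goals
      have hin : i < n := lt_of_le_of_ne (Nat.lt_succ_iff.1 hi) h
      rw [ih hin] at *
      rw [obsRank_succ]
      congr 1
      have hiff : ((relRanks x n : ℕ) < obsRank x n i) ↔ x n ≤ x i :=
        (obsRank_lt_iff x hin).trans
          ⟨le_of_lt, fun hle => hle.lt_of_ne fun he => hin.ne (hx he).symm⟩
      simp_all

theorem seqRetained_relRanks (r : ℕ → ℕ) (x : ℕ → ℝ) (n : ℕ) :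
    seqRetained r (relRanks x) n = retained r x n := by
  induction n with
  | zero => rfl
  | succ n ih =>
    rw [seqRetained, retained, ih, obsRank_succ_self]
    rfl

theorem averageRank_eq_seqSum_div (r : ℕ → ℕ) {x : ℕ → ℝ} (hx : Function.Injective x) (n : ℕ) :
    averageRank r x n = (seqSum r (relRanks x) n : ℝ) / (seqSize r (relRanks x) n : ℝ) := by
  rw [averageRank, seqSum, seqSize, seqRetained_relRanks]
  congr 2
  refine Finset.sum_congr rfl fun i hi => (seqRank_relRanks hx ?_).symm
  rw [← seqRetained_relRanks] at hi
  exact Finset.mem_range.1 (seqRetained_subset r _ n hi)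

theorem perm_eq_of_strictMono {n : ℕ} {x : Fin n → ℝ} {σ τ : Equiv.Perm (Fin n)}
    (hσ : StrictMono fun i => x (σ i)) (hτ : StrictMono fun i => x (τ i)) : σ = τ := by
  have hinj : Function.Injective x := by
    have := hσ.injective.comp σ.symm.injective
    simpa [Function.comp_def] using this
  have h : (fun i => x (σ i)) = fun i => x (τ i) := by
    refine (hσ.range_inj hτ).1 ?_
    rw [show (fun i => x (σ i)) = x ∘ σ from rfl, show (fun i => x (τ i)) = x ∘ τ from rfl,
      σ.surjective.range_comp, τ.surjective.range_comp]
  exact Equiv.ext fun i => hinj (congrFun h i)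

theorem rankHistory_eq_of_strictMono {n : ℕ} {x y : ℕ → ℝ} {σ : Equiv.Perm (Fin n)}
    (hx : StrictMono fun i : Fin n => x (σ i)) (hy : StrictMono fun i : Fin n => y (σ i)) :
    rankHistory n (relRanks x) = rankHistory n (relRanks y) := by
  have hle : ∀ i j : Fin n, x i ≤ x j ↔ y i ≤ y j := by
    intro i j
    have h1 := hx.le_iff_le (a := σ.symm i) (b := σ.symm j)
    have h2 := hy.le_iff_le (a := σ.symm i) (b := σ.symm j)
    simp only [Equiv.apply_symm_apply] at h1 h2
    exact h1.trans h2.symm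
  funext k
  refine Fin.ext ?_
  change obsRank x k k = obsRank y k k
  refine congrArg Finset.card (Finset.filter_congr fun j hj => ?_)
  exact hle ⟨j, (Finset.mem_range.1 hj).trans k.2⟩ k

theorem perm_eq_of_rankHistory_eq {n : ℕ} {x y : ℕ → ℝ} (hx : Function.Injective x)
    (hy : Function.Injective y) (h : rankHistory n (relRanks x) = rankHistory n (relRanks y))
    {σ τ : Equiv.Perm (Fin n)} (hσ : StrictMono fun i : Fin n => x (σ i))
    (hτ : StrictMono fun i : Fin n => y (τ i)) : σ = τ := by
  have hrank : ∀ i < n, obsRank x n i = obsRank y n i := by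
    intro i hi
    rw [← seqRank_relRanks hx hi, ← seqRank_relRanks hy hi]
    exact congrFun (seqRank_dependsOn n fun k hk => congrFun h ⟨k, hk⟩) i
  refine perm_eq_of_strictMono (x := fun i : Fin n => y i) (fun i j hij => ?_) hτ
  simp only
  rw [← obsRank_lt_iff y (σ j).2, ← hrank _ (σ i).2, ← hrank _ (σ j).2,
    obsRank_lt_iff x (σ j).2]
  exact hσ hij

/-! ### The law of the relative ranks of the observations -/

section Law

variable {Ω : Type*} [MeasurableSpace Ω] {P : Measure Ω} {X : ℕ → Ω → ℝ}

theorem measurableSet_ordering (hX : ∀ i, Measurable (X i)) {n : ℕ} (σ : Equiv.Perm (Fin n)) :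
    MeasurableSet {ω | StrictMono fun i : Fin n => X (σ i) ω} := by
  have : {ω | StrictMono fun i : Fin n => X (σ i) ω}
      = ⋂ i : Fin n, ⋂ j : Fin n, ⋂ _ : i < j, {ω | X (σ i) ω < X (σ j) ω} := by
    ext ω
    simp [StrictMono]
  rw [this]
  exact .iInter fun i => .iInter fun j => .iInter fun _ => measurableSet_lt (hX _) (hX _)

theorem ae_injective_of_equallyLikelyOrderings [IsProbabilityMeasure P]
    (hX : ∀ i, Measurable (X i)) (hord : EquallyLikelyOrderings P X) :
    ∀ᵐ ω ∂P, Function.Injective fun i => X i ω := by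
  have h : ∀ n, ∀ᵐ ω ∂P, ∃ σ : Equiv.Perm (Fin n), StrictMono fun i : Fin n => X (σ i) ω := by
    intro n
    have hm : MeasurableSet (⋃ σ : Equiv.Perm (Fin n),
        {ω | StrictMono fun i : Fin n => X (σ i) ω}) :=
      .iUnion fun σ => measurableSet_ordering hX σ
    have h1 : P (⋃ σ : Equiv.Perm (Fin n), {ω | StrictMono fun i : Fin n => X (σ i) ω}) = 1 := by
      rw [measure_iUnion ?_ fun σ => measurableSet_ordering hX σ, tsum_fintype]
      · simp only [hord n, Finset.sum_const, Finset.card_univ, Fintype.card_perm,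
          Fintype.card_fin, nsmul_eq_mul]
        exact ENNReal.mul_inv_cancel (by simpa using n.factorial_ne_zero) (by simp)
      · intro σ τ hne
        refine Set.disjoint_left.2 fun ω hσ hτ => hne ?_
        exact perm_eq_of_strictMono (x := fun i : Fin n => X i ω) hσ hτ
    filter_upwards [(prob_compl_eq_zero_iff hm).2 h1] with ω hω
    simpa using hω
  filter_upwards [ae_all_iff.2 h] with ω hω i j hij
  obtain ⟨σ, hσ⟩ := hω (max i j + 1)
  have hinj : Function.Injective fun k : Fin (max i j + 1) => X k ω := by
    have := hσ.injective.comp σ.symm.injective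
    simpa [Function.comp_def] using this
  have := @hinj ⟨i, by omega⟩ ⟨j, by omega⟩ hij
  simpa using this

theorem measurable_relRanks (hX : ∀ i, Measurable (X i)) :
    Measurable fun ω => relRanks fun i => X i ω := by
  refine measurable_pi_lambda _ fun n => ?_
  have h : Measurable fun ω => obsRank (fun i => X i ω) n n := by
    simp only [obsRank, Finset.card_filter]
    exact Finset.measurable_sum _ fun j _ =>
      Measurable.ite (measurableSet_le (hX j) (hX n)) measurable_const measurable_const
  have e : (fun ω => relRanks (fun i => X i ω) n)
      -- Truncation at `n` changes nothing here and gives a map defined on all of ℕ.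
      = (fun m => ⟨min m n, by omega⟩ : ℕ → Fin (n + 1))
        ∘ fun ω => obsRank (fun i => X i ω) n n := by
    funext ω
    exact Fin.ext (min_eq_left (obsRank_le _ n n)).symm
  rw [e]
  exact (measurable_of_countable _).comp h

/-- An ordering determines the history, and distinct orderings give distinct histories. There are n!
of each, so every history arises from some ordering. -/
theorem exists_ordering_subset [IsProbabilityMeasure P] (hX : ∀ i, Measurable (X i))
    (hord : EquallyLikelyOrderings P X) (n : ℕ) (b : ∀ k : Fin n, Fin ((k : ℕ) + 1)) :
    ∃ σ : Equiv.Perm (Fin n), {ω | StrictMono fun i : Fin n => X (σ i) ω}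
      ⊆ {ω | rankHistory n (relRanks fun i => X i ω) = b} := by
  have hinj := ae_injective_of_equallyLikelyOrderings hX hord
  -- Each ordering has positive probability, so it is realised at a point where the whole sequence
  -- has no ties.
  have hne : ∀ σ : Equiv.Perm (Fin n), ∃ ω, (StrictMono fun i : Fin n => X (σ i) ω) ∧
      Function.Injective fun i => X i ω := by
    intro σ
    have hpos : P {ω | StrictMono fun i : Fin n => X (σ i) ω} ≠ 0 := by
      rw [hord n σ]
      simp
    have hf : ∃ᵐ ω ∂P, StrictMono fun i : Fin n => X (σ i) ω := frequently_ae_iff.2 hpos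
    exact (hf.and_eventually hinj).exists
  choose w hw hwinj using hne
  have hcode : Function.Injective fun σ => rankHistory n (relRanks fun i => X i (w σ)) :=
    fun σ τ h => perm_eq_of_rankHistory_eq (hwinj σ) (hwinj τ) h (hw σ) (hw τ)
  have hcard : Fintype.card (Equiv.Perm (Fin n))
      = Fintype.card (∀ k : Fin n, Fin ((k : ℕ) + 1)) := by
    rw [Fintype.card_perm, Fintype.card_fin, Fintype.card_pi]
    simp only [Fintype.card_fin]
    rw [Fin.prod_univ_eq_prod_range (fun k => k + 1), Finset.prod_range_add_one_eq_factorial]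
  obtain ⟨σ, hσ⟩ := ((Fintype.bijective_iff_injective_and_card _).2 ⟨hcode, hcard⟩).2 b
  refine ⟨σ, fun ω hω => ?_⟩
  exact (rankHistory_eq_of_strictMono (x := fun i => X i ω) (y := fun i => X i (w σ))
    hω (hw σ)).trans hσ

theorem map_rankHistory_relRanks [IsProbabilityMeasure P] (hX : ∀ i, Measurable (X i))
    (hord : EquallyLikelyOrderings P X) (n : ℕ) :
    rankLaw.map (rankHistory n)
      = P.map fun ω => rankHistory n (relRanks fun i => X i ω) := by
  have hm : Measurable fun ω => rankHistory n (relRanks fun i => X i ω) :=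
    (measurable_rankHistory n).comp (measurable_relRanks hX)
  have := Measure.isProbabilityMeasure_map (μ := P) hm.aemeasurable
  have := Measure.isProbabilityMeasure_map (μ := rankLaw) (measurable_rankHistory n).aemeasurable
  -- Between probability measures one inequality suffices, so it is enough that each history
  -- contains an ordering event of probability 1/n!.
  refine Measure.eq_of_le_of_isProbabilityMeasure (Measure.le_iff.2 fun s _ => ?_)
  have hs : s = ((s.toFinite.toFinset : Finset _) : Set _) := by simp
  rw [hs, ← sum_measure_singleton, ← sum_measure_singleton]
  refine Finset.sum_le_sum fun b _ => ?_
  rw [Measure.map_apply (measurable_rankHistory n) (measurableSet_singleton b),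
    Measure.map_apply hm (measurableSet_singleton b)]
  obtain ⟨σ, hσ⟩ := exists_ordering_subset hX hord n b
  refine le_trans (le_of_eq ?_) (measure_mono hσ)
  rw [hord n σ, ← rankLaw_cylinder n (extendHistory n b)]
  congr 1
  ext a
  simp only [Set.mem_preimage, Set.mem_singleton_iff, Set.mem_pi, Finset.mem_coe,
    Finset.mem_range]
  constructor
  · rintro rfl i hi
    simp [extendHistory, rankHistory, hi]
  · intro h
    funext k
    simp [rankHistory, h k k.2, extendHistory]

theorem map_relRanks [IsProbabilityMeasure P] (hX : ∀ i, Measurable (X i))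
    (hord : EquallyLikelyOrderings P X) :
    P.map (fun ω => relRanks fun i => X i ω) = rankLaw := by
  refine Measure.eq_infinitePi _ fun s t ht => ?_
  rw [← Measure.infinitePi_pi (μ := fun n => uniformOn (Set.univ : Set (Fin (n + 1))))
    fun i _ => ht i]
  change _ = rankLaw _
  obtain ⟨n, hn⟩ := s.exists_nat_subset_range
  have e : Set.pi (s : Set ℕ) t
      = rankHistory n ⁻¹' {b | ∀ k : Fin n, (k : ℕ) ∈ s → b k ∈ t k} := by
    ext a
    simp only [Set.mem_pi, Finset.mem_coe, Set.mem_preimage, Set.mem_ofPred_eq, rankHistory]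
    exact ⟨fun h k hk => h k hk, fun h i hi => h ⟨i, Finset.mem_range.1 (hn hi)⟩ hi⟩
  have hB : MeasurableSet {b : ∀ k : Fin n, Fin ((k : ℕ) + 1) |
      ∀ k : Fin n, (k : ℕ) ∈ s → b k ∈ t k} := (Set.toFinite _).measurableSet
  rw [e, ← Measure.map_apply (measurable_rankHistory n) hB,
    ← Measure.map_apply (measurable_rankHistory n) hB,
    Measure.map_map (measurable_rankHistory n) (measurable_relRanks hX),
    map_rankHistory_relRanks hX hord n]
  rfl

end Law

/-! ### Transfer of the limit to the observations -/

theorem theorem5p2 {Ω : Type*} [MeasurableSpace Ω] (P : Measure Ω) [IsProbabilityMeasure P]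
    (X : ℕ → Ω → ℝ) (hX : ∀ i, Measurable (X i)) (hord : EquallyLikelyOrderings P X)
    (p : ℝ) (hp0 : 0 < p) (hp : p < 1 / 2) :
    ∃ Y : Ω → ℝ, Measurable Y ∧
      (∀ᵐ ω ∂P, Tendsto
        (fun n : ℕ => averageRank (percentileThreshold p) (fun i => X i ω) n / (n : ℝ) ^ (1 - p))
        atTop (𝓝 (Y ω))) ∧
      ¬ ∃ c : ℝ, ∀ᵐ ω ∂P, Y ω = c := by
  have hρ := measurable_relRanks hX
  have hlaw := map_relRanks hX hord
  obtain ⟨Z, hZ, hlim⟩ := measurable_limit_of_tendsto_metrizable_ae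
    (fun n => Measurable.aemeasurable (DependsOn.measurable_rankSeq (n := n) fun a b hab => by
      rw [show seqSum (percentileThreshold p) a n = seqSum (percentileThreshold p) b n from
          seqSum_dependsOn _ n hab,
        show seqSize (percentileThreshold p) a n = seqSize (percentileThreshold p) b n from
          seqSize_dependsOn _ n hab]))
    (ae_tendsto_seqSum_div_seqSize hp0 hp)
  refine ⟨fun ω => Z (relRanks fun i => X i ω), hZ.comp hρ, ?_, ?_⟩
  · have h := hlim
    rw [← hlaw] at h
    filter_upwards [ae_of_ae_map hρ.aemeasurable h,
      ae_injective_of_equallyLikelyOrderings hX hord] with ω h1 h2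
    simpa only [averageRank_eq_seqSum_div _ h2] using h1
  · rintro ⟨c, hc⟩
    refine not_ae_tendsto_const hp0 hp c ?_
    have h : ∀ᵐ a ∂rankLaw, Z a = c := by
      rw [← hlaw]
      exact (ae_map_iff hρ.aemeasurable (hZ (measurableSet_singleton c))).2 hc
    filter_upwards [hlim, h] with a h1 h2
    exact h2 ▸ h1
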